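/- Let $I$ be a finite nonempty set. A tree on $I$ is a rooted binary tree (not considered as planar) whose leaves are bijectively labelled by $I$; the vertices other than the leaves and the root are its inner vertices, each having exactly two incoming edges and one outgoing edge, edges being oriented from the leaves towards the root (a tree with a single leaf is just an edge from the leaf to the root). A forest on $I$ is a set of such trees on the blocks of a partition of $I$. Both are considered up to isomorphism fixing the leaf labels. The forests on $I$ are partially ordered by: $F\le G$ if there is a topological map from $F$ to $G$ that is increasing with respect to the orientation towards the root, maps inner vertices to inner vertices injectively, restricts to the identity of $I$ on the leaves, and is injective on each tree of $F$. Let $\hat 0$ be the forest on $I$ without inner vertices. Then for every tree $T$ on $I$ the interval $[\hat 0,T]=\{F : \hat 0\le F\le T\}$, with the induced order, is a supersolvable lattice: it is a finite lattice that contains a maximal chain $M$ such that, for every chain $C$ of $[\hat 0,T]$, the sublattice generated by $M\cup C$ is distributive. -/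

import Mathlib

/-- A forest of leaf-labelled rooted binary trees (not planar) on the finite label set `I`.
Each leaf or inner vertex is recorded by its set of ancestor leaves, i.e. the set of the leaves
whose path to the root goes through it. A leaf `i` is the set `{i}`; two vertices are
either on a common path to the root (nested sets) or not (disjoint sets); an inner vertex has
exactly two incoming edges, which come from two vertices sharing its ancestor leaves between
them. The valence one root below each tree carries no further data and is not recorded. -/
@[ext]
structure Forest (I : Type*) [DecidableEq I] where
  /-- the leaves and the inner vertices -/
  verts : Finset (Finset I)
  nonempty : ∀ v ∈ verts, v.Nonempty
  leaf_mem : ∀ i : I, {i} ∈ verts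
  laminar : ∀ v ∈ verts, ∀ w ∈ verts, v ⊆ w ∨ w ⊆ v ∨ Disjoint v w
  binary : ∀ v ∈ verts, 2 ≤ v.card → ∃ a ∈ verts, ∃ b ∈ verts, Disjoint a b ∧ a ∪ b = v

namespace Forest

/-- The leaves and inner vertices of `F`. Being a subtype of `Finset I` it is ordered by
inclusion: `v ≤ w` means that `w` is on the path from `v` to the root, and `v ⋖ w` means that
there is an edge from `v` to `w`. -/
abbrev Vertex {I : Type*} [DecidableEq I] (F : Forest I) : Type _ := {v : Finset I // v ∈ F.verts}

/-- The leaf with label `i`. -/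
def leaf {I : Type*} [DecidableEq I] (F : Forest I) (i : I) : F.Vertex := ⟨{i}, F.leaf_mem i⟩

/-- Inner vertices are the vertices that are not leaves. -/
def IsInner {I : Type*} [DecidableEq I] {F : Forest I} (v : F.Vertex) : Prop :=
  ∀ i : I, v ≠ F.leaf i

/-- Two vertices belong to the same tree of `F` if their paths to the root meet. -/
def SameTree {I : Type*} [DecidableEq I] {F : Forest I} (v w : F.Vertex) : Prop :=
  ∃ r : F.Vertex, v ≤ r ∧ w ≤ r

/-- `F` consists of a single tree: there is a leaf or inner vertex through which all the paths
from the leaves to the root go. -/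
def IsTree {I : Type*} [DecidableEq I] (F : Forest I) : Prop :=
  ∃ r : F.Vertex, ∀ v : F.Vertex, v ≤ r

/-- The topological maps `F → G` used to compare forests, up to isotopy: such a map is given by
the images of the vertices, an edge `v ⋖ p` of `F` being sent to the path
from `φ v` down to `φ p`. The set `Set.Ico (φ v) (φ p)` consists of the vertices on that path
except for its end `φ p`; it also records the edges of the path, by their starting points. -/
structure IsForestMap {I : Type*} [DecidableEq I] {F G : Forest I}
    (φ : F.Vertex → G.Vertex) : Prop where
  /-- increasing with respect to the orientation towards the root -/
  monotone : Monotone φ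
  /-- maps inner vertices to inner vertices -/
  inner : ∀ v, IsInner v → IsInner (φ v)
  /-- is injective on inner vertices -/
  inner_injective : ∀ v w, IsInner v → IsInner w → φ v = φ w → v = w
  /-- restricts to the identity of `I` on leaves -/
  leaf : ∀ i, φ (F.leaf i) = G.leaf i
  /-- the restriction to each tree of `F` is injective: on vertices -/
  tree_injective : ∀ v w, SameTree v w → φ v = φ w → v = w
  /-- the restriction to each tree of `F` is injective: two distinct edges `v ⋖ p` and `w ⋖ q`
  of the same tree are sent to paths without a common edge or inner point -/
  tree_disjoint : ∀ v p w q, v ⋖ p → w ⋖ q → SameTree p q → v ≠ w →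
    Disjoint (Set.Ico (φ v) (φ p)) (Set.Ico (φ w) (φ q))

theorem IsForestMap.id {I : Type*} [DecidableEq I] (F : Forest I) :
    IsForestMap (fun v : F.Vertex => v) where
  monotone := monotone_id
  inner _ h := h
  inner_injective _ _ _ _ h := h
  leaf _ := rfl
  tree_injective _ _ _ h := h
  tree_disjoint := by
    intro v p w q hv hw _ hne
    rw [Set.disjoint_left]
    rintro u ⟨h1, h2⟩ ⟨h3, h4⟩
    have e1 : v = u := by
      rcases h1.lt_or_eq with h | h
      · exact absurd h2 (hv.2 h)
      · exact h
    have e2 : w = u := by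
      rcases h3.lt_or_eq with h | h
      · exact absurd h4 (hw.2 h)
      · exact h
    exact hne (e1.trans e2.symm)

/-- A point of the image of a path of `G` lies on the image of an edge of that path. -/
theorem exists_edge {I : Type*} [DecidableEq I] {G H : Forest I} (ψ : G.Vertex → H.Vertex)
    (u : H.Vertex) (x y : G.Vertex) (hxy : x ≤ y) (h1 : ψ x ≤ u) (h2 : u < ψ y)
    (hc : ∀ z, x ≤ z → z ≤ y → ψ z ≤ u ∨ u < ψ z) :
    ∃ a b, x ≤ a ∧ a ⋖ b ∧ b ≤ y ∧ u ∈ Set.Ico (ψ a) (ψ b) := by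
  have hfin : (Set.univ : Set G.Vertex).Finite := Set.finite_univ
  obtain ⟨a, ⟨ha1, ha2, ha3⟩, hmax⟩ :=
    (hfin.subset (Set.subset_univ {z | x ≤ z ∧ z ≤ y ∧ ψ z ≤ u})).exists_maximal
      ⟨x, le_rfl, hxy, h1⟩
  have hay : a < y := lt_of_le_of_ne ha2 (fun h => absurd (h ▸ ha3) (not_le_of_gt h2))
  obtain ⟨b, ⟨hb1, hb2⟩, hmin⟩ :=
    (hfin.subset (Set.subset_univ {z | a < z ∧ z ≤ y})).exists_minimal ⟨y, hay, le_rfl⟩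
  refine ⟨a, b, ha1, ⟨hb1, fun c hac hcb => ?_⟩, hb2, ha3, ?_⟩
  · exact absurd (hmin ⟨hac, hcb.le.trans hb2⟩ hcb.le) (not_le_of_gt hcb)
  · rcases hc b (ha1.trans hb1.le) hb2 with h | h
    · exact absurd (hmax ⟨ha1.trans hb1.le, hb2, h⟩ hb1.le) (not_le_of_gt hb1)
    · exact h

/-- The vertices below a given one form a path. -/
theorem le_or_lt_of_le {I : Type*} [DecidableEq I] {F : Forest I} {v a b : F.Vertex}
    (ha : v ≤ a) (hb : v ≤ b) : a ≤ b ∨ b < a := by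
  rcases F.laminar a a.2 b b.2 with h | h | h
  · exact Or.inl h
  · rcases (show b ≤ a from h).lt_or_eq with h | h
    · exact Or.inr h
    · exact Or.inl h.ge
  · obtain ⟨i, hi⟩ := F.nonempty v v.2
    exact absurd (hb hi) (Finset.disjoint_left.1 h (ha hi))

theorem IsForestMap.comp {I : Type*} [DecidableEq I] {F G H : Forest I}
    {ψ : G.Vertex → H.Vertex} {φ : F.Vertex → G.Vertex} (hψ : IsForestMap ψ)
    (hφ : IsForestMap φ) : IsForestMap (fun v => ψ (φ v)) where
  monotone := hψ.monotone.comp hφ.monotone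
  inner v h := hψ.inner _ (hφ.inner v h)
  inner_injective v w hv hw h :=
    hφ.inner_injective v w hv hw
      (hψ.inner_injective _ _ (hφ.inner v hv) (hφ.inner w hw) h)
  leaf i := by rw [hφ.leaf, hψ.leaf]
  tree_injective := by
    rintro v w ⟨r, h1, h2⟩ h
    exact hφ.tree_injective v w ⟨r, h1, h2⟩
      (hψ.tree_injective _ _ ⟨φ r, hφ.monotone h1, hφ.monotone h2⟩ h)
  tree_disjoint := by
    rintro v p w q hv hw ⟨r, hp, hq⟩ hne
    rw [Set.disjoint_left]
    rintro u ⟨h1, h2⟩ ⟨h3, h4⟩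
    obtain ⟨a, b, a1, a2, a3, a4⟩ := exists_edge ψ u (φ v) (φ p) (hφ.monotone hv.le) h1 h2
      (fun z hz _ => le_or_lt_of_le (hψ.monotone hz) h1)
    obtain ⟨c, d, c1, c2, c3, c4⟩ := exists_edge ψ u (φ w) (φ q) (hφ.monotone hw.le) h3 h4
      (fun z hz _ => le_or_lt_of_le (hψ.monotone hz) h3)
    have hac : a ≠ c := by
      intro h
      refine (Set.disjoint_left.1 (hφ.tree_disjoint v p w q hv hw ⟨r, hp, hq⟩ hne))
        ⟨a1, a2.lt.trans_le a3⟩ ?_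
      rw [h]
      exact ⟨c1, c2.lt.trans_le c3⟩
    exact Set.disjoint_left.1 (hψ.tree_disjoint a b c d a2 c2
      ⟨φ r, a3.trans (hφ.monotone hp), c3.trans (hφ.monotone hq)⟩ hac) a4 c4

theorem IsForestMap.subset {I : Type*} [DecidableEq I] {F G : Forest I}
    {φ : F.Vertex → G.Vertex} (hφ : IsForestMap φ) (v : F.Vertex) : v.1 ⊆ (φ v).1 := by
  intro i hi
  have h : φ (F.leaf i) ≤ φ v := hφ.monotone (Finset.singleton_subset_iff.2 hi)
  rw [hφ.leaf] at h
  exact Finset.singleton_subset_iff.1 h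

theorem IsForestMap.injective {I : Type*} [DecidableEq I] {F G : Forest I}
    {φ : F.Vertex → G.Vertex} (hφ : IsForestMap φ) : Function.Injective φ := by
  intro v w h
  by_cases hv : IsInner v
  · by_cases hw : IsInner w
    · exact hφ.inner_injective v w hv hw h
    · obtain ⟨i, rfl⟩ := by simpa [IsInner] using hw
      exact absurd (h.trans (hφ.leaf i)) (hφ.inner v hv i)
  · obtain ⟨i, rfl⟩ := by simpa [IsInner] using hv
    by_cases hw : IsInner w
    · exact absurd (h.symm.trans (hφ.leaf i)) (hφ.inner w hw i)
    · obtain ⟨j, rfl⟩ := by simpa [IsInner] using hw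
      rw [hφ.leaf, hφ.leaf] at h
      have : i = j := Finset.singleton_injective (congrArg Subtype.val h)
      rw [this]

theorem IsForestMap.eq_self {I : Type*} [DecidableEq I] {F : Forest I}
    {φ : F.Vertex → F.Vertex} (hφ : IsForestMap φ) (v : F.Vertex) : φ v = v := by
  have hsum : ∑ w : F.Vertex, (φ w).1.card = ∑ w : F.Vertex, w.1.card :=
    (Finite.injective_iff_bijective.1 hφ.injective).sum_comp (fun w : F.Vertex => w.1.card)
  have := (Finset.sum_eq_sum_iff_of_le
    (fun w _ => Finset.card_le_card (hφ.subset w))).1 hsum.symm v (Finset.mem_univ _)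
  exact (Subtype.ext (Finset.eq_of_subset_of_card_le (hφ.subset v) this.ge)).symm

theorem verts_subset {I : Type*} [DecidableEq I] {F G : Forest I}
    {φ : F.Vertex → G.Vertex} {ψ : G.Vertex → F.Vertex} (hφ : IsForestMap φ)
    (hψ : IsForestMap ψ) : F.verts ⊆ G.verts := by
  intro v hv
  have h1 := hφ.subset ⟨v, hv⟩
  have h2 := hψ.subset (φ ⟨v, hv⟩)
  have h3 : ψ (φ ⟨v, hv⟩) = ⟨v, hv⟩ := (hψ.comp hφ).eq_self _
  rw [h3] at h2
  have h4 : v = (φ ⟨v, hv⟩).1 := Finset.Subset.antisymm h1 h2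
  rw [h4]
  exact (φ ⟨v, hv⟩).2

/-- The partial order on the forests on `I`. -/
instance {I : Type*} [DecidableEq I] : PartialOrder (Forest I) where
  le F G := ∃ φ : F.Vertex → G.Vertex, IsForestMap φ
  le_refl F := ⟨_, IsForestMap.id F⟩
  le_trans := by
    rintro F G H ⟨φ, hφ⟩ ⟨ψ, hψ⟩
    exact ⟨_, hψ.comp hφ⟩
  le_antisymm := by
    rintro F G ⟨φ, hφ⟩ ⟨ψ, hψ⟩
    exact Forest.ext (Finset.Subset.antisymm (verts_subset hφ hψ) (verts_subset hψ hφ))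

/-- The forest without inner vertices. -/
def zero (I : Type*) [Fintype I] [DecidableEq I] : Forest I where
  verts := Finset.univ.image (fun i => {i})
  nonempty := by simp
  leaf_mem := by simp
  laminar := by
    simp only [Finset.mem_image, Finset.mem_univ, true_and]
    rintro _ ⟨i, rfl⟩ _ ⟨j, rfl⟩
    by_cases h : i = j
    · simp [h]
    · simp [h]
  binary := by simp

end Forest

/-- A finite lattice is supersolvable if it has a maximal chain which together with any
chain generates a distributive sublattice. -/
def IsSupersolvable (L : Type*) [Lattice L] : Prop :=
  Finite L ∧ ∃ M : Flag L, ∀ C : Set L, IsChain (· ≤ ·) C →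
    ∀ a ∈ latticeClosure ((M : Set L) ∪ C), ∀ b ∈ latticeClosure ((M : Set L) ∪ C),
      ∀ c ∈ latticeClosure ((M : Set L) ∪ C), a ⊓ (b ⊔ c) = (a ⊓ b) ⊔ (a ⊓ c)

/-! A forest `F ≤ T` is determined by the partition of `I` into the leaf sets of its trees: each
tree is the restriction of `T` to a block. The partitions that occur are the valid ones, whose
blocks use pairwise different inner vertices of `T` (`Forest.le_iff`, `Forest.restrict`), and the
order becomes refinement (`Forest.trees_le_trees_iff`). Intersections of valid partitions are valid,
so these form a lattice, whose joins may be coarser than joins of partitions.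

Number the vertices of `T` increasingly towards the root. The number of the vertex where the paths
from two leaves meet is an ultrametric distance. Let `V` send a valid partition to the set of
distances inside its blocks, that is, to the inner vertices it uses. Then `V` is strictly monotone
(`le_of_values_subset`). The chain `M` consists of the partitions into balls. Meeting with a ball
intersects the values of `V`; joining with a ball unites them (`exists_valid_sup`), because adding
one vertex means merging the two blocks on its two sides, which creates no other new distance.

The rest is lattice theory. Comparing values of `V` shows that joins of meets `a ⊓ c`, with `a ∈ M`
and `c ∈ C`, are also meets of joins `a ⊔ c`. These elements form a sublattice containing `M ∪ C`,
on which `V` is an injective homomorphism to a lattice of sets. -/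

section Lattice

/-! ### Distributivity from a set-valued function on a finite lattice -/

variable {L : Type*} [CompleteLattice L] [Finite L] {α : Type*} {V : L → Set α} {A C : Set L}

/-- Joins of the meets `a ⊓ c`, rewritten as meets of joins `a ⊔ c`. -/
theorem iSup_inf_eq_iInf_sup (hV : Monotone V) (hs : ∀ x y, x ≤ y → V y ⊆ V x → y ≤ x)
    (hbot : V ⊥ = ∅) (hA : IsChain (· ≤ ·) A) (hC : IsChain (· ≤ ·) C) (hA0 : ⊥ ∈ A)
    (hC0 : ⊥ ∈ C) (hinf : ∀ x, ∀ a ∈ A, V x ∩ V a ⊆ V (x ⊓ a))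
    (hsup : ∀ x, ∀ a ∈ A, V (x ⊔ a) ⊆ V x ∪ V a) (P : Set (L × L)) (hP : P ⊆ A ×ˢ C) :
    (⨆ p ∈ P, p.1 ⊓ p.2) =
        (⨅ q ∈ {q ∈ A ×ˢ C | ∀ p ∈ P, p.1 ≤ q.1 ∨ p.2 ≤ q.2}, q.1 ⊔ q.2) ∧
      V (⨆ p ∈ P, p.1 ⊓ p.2) = ⋃ p ∈ P, V p.1 ∩ V p.2 := by
  set x := ⨆ p ∈ P, p.1 ⊓ p.2
  set y := ⨅ q ∈ {q ∈ A ×ˢ C | ∀ p ∈ P, p.1 ≤ q.1 ∨ p.2 ≤ q.2}, q.1 ⊔ q.2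
  have hxy : x ≤ y := by
    refine iSup₂_le fun p hp => le_iInf₂ fun q hq => ?_
    rcases hq.2 p hp with h | h
    · exact inf_le_left.trans (h.trans le_sup_left)
    · exact inf_le_right.trans (h.trans le_sup_right)
  have hSx : (⋃ p ∈ P, V p.1 ∩ V p.2) ⊆ V x := by
    refine Set.iUnion₂_subset fun p hp => ?_
    rw [Set.inter_comm]
    refine (hinf _ _ (hP hp).1).trans (hV ?_)
    rw [inf_comm]
    exact le_iSup₂_of_le p hp le_rfl
  have hyS : V y ⊆ ⋃ p ∈ P, V p.1 ∩ V p.2 := by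
    intro v hv
    by_contra hvS
    -- Take the largest `a` and `c` in the two chains whose values miss `v`. Each `p ∈ P` has a
    -- component missing `v`, hence below `a` or `c`, so `a ⊔ c` is one of the joins over which the
    -- infimum runs.
    obtain ⟨a, ⟨ha1, ha2⟩, ha3⟩ := (Set.toFinite {a ∈ A | v ∉ V a}).exists_maximal
      ⟨⊥, hA0, by simp [hbot]⟩
    obtain ⟨c, ⟨hc1, hc2⟩, hc3⟩ := (Set.toFinite {c ∈ C | v ∉ V c}).exists_maximal
      ⟨⊥, hC0, by simp [hbot]⟩
    have hq : (a, c) ∈ {q ∈ A ×ˢ C | ∀ p ∈ P, p.1 ≤ q.1 ∨ p.2 ≤ q.2} := by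
      refine ⟨⟨ha1, hc1⟩, fun p hp => ?_⟩
      by_cases h : v ∈ V p.1
      · right
        have h2 : v ∉ V p.2 := fun h2 => hvS (Set.mem_iUnion₂.2 ⟨p, hp, h, h2⟩)
        rcases hC.total (hP hp).2 hc1 with h' | h'
        · exact h'
        · exact hc3 ⟨(hP hp).2, h2⟩ h'
      · left
        rcases hA.total (hP hp).1 ha1 with h' | h'
        · exact h'
        · exact ha3 ⟨(hP hp).1, h⟩ h'
    have h1 : y ≤ c ⊔ a := by
      rw [sup_comm]
      exact iInf₂_le (a, c) hq
    rcases hsup c a ha1 (hV h1 hv) with h | h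
    · exact hc2 h
    · exact ha2 h
  exact ⟨le_antisymm hxy (hs _ _ hxy (hyS.trans hSx)),
    ((hV hxy).trans hyS).antisymm hSx⟩

/-- Meets of the joins `a ⊔ c`, rewritten as joins of meets `a ⊓ c`. -/
theorem iInf_sup_eq_iSup_inf (hV : Monotone V) (hs : ∀ x y, x ≤ y → V y ⊆ V x → y ≤ x)
    (hA : IsChain (· ≤ ·) A) (hC : IsChain (· ≤ ·) C) (hA1 : ⊤ ∈ A)
    (hC1 : ⊤ ∈ C) (hinf : ∀ x, ∀ a ∈ A, V x ∩ V a ⊆ V (x ⊓ a))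
    (hsup : ∀ x, ∀ a ∈ A, V (x ⊔ a) ⊆ V x ∪ V a) (Q : Set (L × L)) (hQ : Q ⊆ A ×ˢ C) :
    (⨅ q ∈ Q, q.1 ⊔ q.2) =
        (⨆ p ∈ {p ∈ A ×ˢ C | ∀ q ∈ Q, p.1 ≤ q.1 ∨ p.2 ≤ q.2}, p.1 ⊓ p.2) ∧
      V (⨅ q ∈ Q, q.1 ⊔ q.2) = V ⊤ ∩ ⋂ q ∈ Q, V q.1 ∪ V q.2 := by
  set y := ⨅ q ∈ Q, q.1 ⊔ q.2
  set x := ⨆ p ∈ {p ∈ A ×ˢ C | ∀ q ∈ Q, p.1 ≤ q.1 ∨ p.2 ≤ q.2}, p.1 ⊓ p.2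
  have hxy : x ≤ y := by
    refine iSup₂_le fun p hp => le_iInf₂ fun q hq => ?_
    rcases hp.2 q hq with h | h
    · exact inf_le_left.trans (h.trans le_sup_left)
    · exact inf_le_right.trans (h.trans le_sup_right)
  have hyS : V y ⊆ V ⊤ ∩ ⋂ q ∈ Q, V q.1 ∪ V q.2 := by
    refine Set.subset_inter (hV le_top) (Set.subset_iInter₂ fun q hq => ?_)
    rw [Set.union_comm]
    refine (hV ?_).trans (hsup _ _ (hQ hq).1)
    rw [sup_comm]
    exact iInf₂_le q hq
  have hSx : (V ⊤ ∩ ⋂ q ∈ Q, V q.1 ∪ V q.2) ⊆ V x := by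
    rintro v ⟨hv1, hv⟩
    rw [Set.mem_iInter₂] at hv
    obtain ⟨a, ⟨ha1, ha2⟩, ha3⟩ := (Set.toFinite {a ∈ A | v ∈ V a}).exists_minimal
      ⟨⊤, hA1, hv1⟩
    obtain ⟨c, ⟨hc1, hc2⟩, hc3⟩ := (Set.toFinite {c ∈ C | v ∈ V c}).exists_minimal
      ⟨⊤, hC1, hv1⟩
    have hp : (a, c) ∈ {p ∈ A ×ˢ C | ∀ q ∈ Q, p.1 ≤ q.1 ∨ p.2 ≤ q.2} := by
      refine ⟨⟨ha1, hc1⟩, fun q hq => ?_⟩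
      rcases hv q hq with h | h
      · left
        rcases hA.total ha1 (hQ hq).1 with h' | h'
        · exact h'
        · exact ha3 ⟨(hQ hq).1, h⟩ h'
      · right
        rcases hC.total hc1 (hQ hq).2 with h' | h'
        · exact h'
        · exact hc3 ⟨(hQ hq).2, h⟩ h'
    have h1 : c ⊓ a ≤ x := by
      rw [inf_comm]
      exact le_iSup₂_of_le (a, c) hp le_rfl
    exact hV h1 (hinf c a ha1 ⟨hc2, ha2⟩)
  exact ⟨le_antisymm (hs _ _ hxy (hyS.trans hSx)) hxy,
    hyS.antisymm (hSx.trans (hV hxy))⟩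

/-- If a strictly monotone set-valued function turns meets and joins with the members of a chain
`A` into intersections and unions, then `A` and any other chain generate a distributive
sublattice. -/
theorem inf_sup_left_of_mem_latticeClosure (hV : Monotone V)
    (hs : ∀ x y, x ≤ y → V y ⊆ V x → y ≤ x)
    (hbot : V ⊥ = ∅) (hA : IsChain (· ≤ ·) A) (hC : IsChain (· ≤ ·) C) (hA0 : ⊥ ∈ A)
    (hA1 : ⊤ ∈ A) (hinf : ∀ x, ∀ a ∈ A, V x ∩ V a ⊆ V (x ⊓ a))
    (hsup : ∀ x, ∀ a ∈ A, V (x ⊔ a) ⊆ V x ∪ V a) {a b c : L}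
    (ha : a ∈ latticeClosure (A ∪ C)) (hb : b ∈ latticeClosure (A ∪ C))
    (hc : c ∈ latticeClosure (A ∪ C)) : a ⊓ (b ⊔ c) = (a ⊓ b) ⊔ (a ⊓ c) := by
  -- The rewritings choose extremal members of both chains, so both must contain `⊥` and `⊤`.
  set D : Set L := insert ⊤ (insert ⊥ C)
  have hD : IsChain (· ≤ ·) D :=
    (hC.insert fun _ _ _ => Or.inl bot_le).insert fun _ _ _ => Or.inr le_top
  have hD0 : ⊥ ∈ D := by simp [D]
  have hD1 : ⊤ ∈ D := by simp [D]
  set Z : Set L := {x | ∃ P ⊆ A ×ˢ D, x = ⨆ p ∈ P, p.1 ⊓ p.2}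
  have key1 := iSup_inf_eq_iInf_sup hV hs hbot hA hD hA0 hD0 hinf hsup
  have key2 := iInf_sup_eq_iSup_inf hV hs hA hD hA1 hD1 hinf hsup
  have hZsup : ∀ x ∈ Z, ∀ y ∈ Z, x ⊔ y ∈ Z ∧ V (x ⊔ y) = V x ∪ V y := by
    rintro x ⟨P, hP, rfl⟩ y ⟨Q, hQ, rfl⟩
    rw [← iSup_union, (key1 P hP).2, (key1 Q hQ).2,
      (key1 (P ∪ Q) (Set.union_subset hP hQ)).2, Set.biUnion_union]
    exact ⟨⟨P ∪ Q, Set.union_subset hP hQ, rfl⟩, rfl⟩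
  -- As meets of joins the two elements have an obvious meet, which is then turned back into a join
  -- of meets.
  have hZinf : ∀ x ∈ Z, ∀ y ∈ Z, x ⊓ y ∈ Z ∧ V (x ⊓ y) = V x ∩ V y := by
    rintro x ⟨P, hP, rfl⟩ y ⟨Q, hQ, rfl⟩
    rw [(key1 P hP).1, (key1 Q hQ).1, ← iInf_union, (key2 _ (Set.sep_subset _ _)).2,
      (key2 _ (Set.sep_subset _ _)).2,
      (key2 _ (Set.union_subset (Set.sep_subset _ _) (Set.sep_subset _ _))).2,
      Set.biInter_union, Set.inter_inter_distrib_left]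
    exact ⟨⟨_, Set.sep_subset _ _,
      (key2 _ (Set.union_subset (Set.sep_subset _ _) (Set.sep_subset _ _))).1⟩, rfl⟩
  have hZ : latticeClosure (A ∪ C) ⊆ Z := by
    refine latticeClosure_min ?_ ⟨fun x hx y hy => (hZsup x hx y hy).1,
      fun x hx y hy => (hZinf x hx y hy).1⟩
    rintro x (hx | hx)
    · exact ⟨{(x, ⊤)}, by simpa using ⟨hx, hD1⟩, by simp⟩
    · exact ⟨{(⊤, x)}, by simpa [D] using ⟨hA1, Or.inr (Or.inr hx)⟩, by simp⟩
  -- Strictness concerns comparable elements only, so `x` and `y` are compared through `x ⊔ y`.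
  have hinj : ∀ x ∈ Z, ∀ y ∈ Z, V x = V y → x = y := by
    intro x hx y hy h
    have h1 := (hZsup x hx y hy).2
    rw [← h, Set.union_self] at h1
    have h2 := hs x (x ⊔ y) le_sup_left h1.le
    have h3 := hs y (x ⊔ y) le_sup_right (h1.le.trans h.le)
    exact le_antisymm (le_sup_left.trans h3) (le_sup_right.trans h2)
  have ha := hZ ha
  have hb := hZ hb
  have hc := hZ hc
  obtain ⟨h1, h1'⟩ := hZsup b hb c hc
  obtain ⟨h2, h2'⟩ := hZinf a ha b hb
  obtain ⟨h3, h3'⟩ := hZinf a ha c hc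
  obtain ⟨h4, h4'⟩ := hZinf a ha _ h1
  obtain ⟨h5, h5'⟩ := hZsup _ h2 _ h3
  refine hinj _ h4 _ h5 ?_
  rw [h4', h1', h5', h2', h3', Set.inter_union_distrib_left]

/-- The chain is maximal because each step adds at most one element to `V`, and strictness leaves no
room for an element in between. Repetitions in `m` are harmless. -/
theorem isSupersolvable_of_strictMono {V : L → Set ℕ} (hV : Monotone V)
    (hs : ∀ x y, x ≤ y → V y ⊆ V x → y ≤ x) (hbot : V ⊥ = ∅) {m : ℕ → L} (hm : Monotone m)
    (hm0 : m 0 = ⊥) {N : ℕ} (hmN : m N = ⊤) (hstep : ∀ k, V (m (k + 1)) ⊆ insert k (V (m k)))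
    (hinf : ∀ x k, V x ∩ V (m k) ⊆ V (x ⊓ m k))
    (hsup : ∀ x k, V (x ⊔ m k) ⊆ V x ∪ V (m k)) : IsSupersolvable L := by
  have hchain : IsChain (· ≤ ·) (Set.range m) := hm.isChain_range
  have hmax : ∀ t : Set L, IsChain (· ≤ ·) t → Set.range m ⊆ t → Set.range m = t := by
    intro t ht hmt
    refine hmt.antisymm fun x hx => ?_
    have hcmp : ∀ k, m k ≤ x ∨ x ≤ m k := fun k => ht.total (hmt ⟨k, rfl⟩) hx
    by_cases hN : m N ≤ x
    · exact ⟨N, le_antisymm hN (hmN ▸ le_top)⟩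
    classical
    have hex : ∃ k, ¬ m k ≤ x := ⟨N, hN⟩
    obtain ⟨k, hk⟩ : ∃ k, Nat.find hex = k + 1 := by
      refine Nat.exists_eq_succ_of_ne_zero fun h => Nat.find_spec hex ?_
      rw [h, hm0]
      exact bot_le
    have h1 : ¬ m (k + 1) ≤ x := hk ▸ Nat.find_spec hex
    have h2 : m k ≤ x := not_not.1 (Nat.find_min hex (by omega))
    have h3 : x ≤ m (k + 1) := (hcmp _).resolve_left h1
    by_cases hkx : k ∈ V x
    · refine absurd (hs _ _ h3 ((hstep k).trans ?_)) h1
      exact Set.insert_subset hkx (hV h2)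
    · refine ⟨k, le_antisymm h2 (hs _ _ h2 fun v hv => ?_)⟩
      rcases hstep k (hV h3 hv) with h | h
      · exact absurd (h ▸ hv) hkx
      · exact h
  refine ⟨inferInstance, ⟨Set.range m, hchain, fun t ht h => hmax t ht h⟩, ?_⟩
  intro C hC a ha b hb c hc
  refine inf_sup_left_of_mem_latticeClosure hV hs hbot hchain hC ⟨0, hm0⟩ ⟨N, hmN⟩ ?_ ?_ ha hb hc
  · rintro x _ ⟨k, rfl⟩
    exact hinf x k
  · rintro x _ ⟨k, rfl⟩
    exact hsup x k

end Lattice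
-- Valid partitions of a binary ultrametric space
/-- Distances of the leaves of a rooted binary tree: an ultrametric with values in `ℕ`, such that
the pairs at a given distance are those between two disjoint classes of closer points. -/
structure BinaryUltrametric (I : Type*) where
  dist : I → I → ℕ
  symm : ∀ i j, dist i j = dist j i
  ultra : ∀ i j k, dist i k ≤ max (dist i j) (dist j k)
  binary : ∀ i j k l, i ≠ j → dist i j = dist k l →
    (dist i k < dist i j ∧ dist j l < dist i j) ∨ (dist i l < dist i j ∧ dist j k < dist i j)

namespace BinaryUltrametric

variable {I : Type*} (d : BinaryUltrametric I)

/-- Different blocks of the partition have no distance in common. -/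
def Valid (r : Setoid I) : Prop :=
  ∀ i j k l, i ≠ j → k ≠ l → r i j → r k l → d.dist i j = d.dist k l → r i k

/-- The distances within the blocks of a partition. -/
def values (r : Setoid I) : Set ℕ := {n | ∃ i j, i ≠ j ∧ r i j ∧ d.dist i j = n}

theorem values_mono : Monotone d.values := by
  rintro r s h n ⟨i, j, hij, hr, hn⟩
  exact ⟨i, j, hij, h hr, hn⟩

theorem values_bot : d.values ⊥ = ∅ := by
  ext n
  simp only [Set.mem_empty_iff_false, iff_false]
  rintro ⟨i, j, hij, h, -⟩
  exact hij h

theorem valid_top : d.Valid ⊤ := fun _ _ _ _ _ _ _ _ _ => trivial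

theorem valid_sInf (S : Set (Setoid I)) (hS : ∀ r ∈ S, d.Valid r) : d.Valid (sInf S) :=
  fun i j k l hij hkl h1 h2 h r hr => hS r hr i j k l hij hkl (h1 r hr) (h2 r hr) h

theorem dist_self_lt {i j : I} (h : i ≠ j) : d.dist i i < d.dist i j := by
  rcases d.binary i j i j h rfl with h | h
  · exact h.1
  · exact absurd h.1 (lt_irrefl _)

/-- Induction on the distance of an `s`-related pair `i, j`. Some `r`-related pair `k, l` has the
same distance, and validity puts all four points into one block of `s`. The points `i, j` are closer
to `k, l` in some order, so induction links them in `r` through `k` and `l`. -/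
theorem le_of_values_subset {r s : Setoid I} (hrs : r ≤ s) (hs : d.Valid s)
    (h : d.values s ⊆ d.values r) : s ≤ r := by
  have main : ∀ n i j, d.dist i j = n → s i j → r i j := by
    intro n
    induction n using Nat.strong_induction_on with
    | _ n ih =>
      intro i j hn hij
      by_cases hne : i = j
      · exact hne ▸ r.refl i
      obtain ⟨k, l, hkl, hr, hd⟩ := h ⟨i, j, hne, hij, hn⟩
      have hik := hs i j k l hne hkl hij (hrs hr) (hn.trans hd.symm)
      have hjk := s.trans (s.symm hij) hik
      have hil := s.trans hik (hrs hr)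
      have hjl := s.trans hjk (hrs hr)
      rcases d.binary i j k l hne (hn.trans hd.symm) with ⟨h1, h2⟩ | ⟨h1, h2⟩
      · exact r.trans (ih _ (hn ▸ h1) i k rfl hik)
          (r.trans hr (r.symm (ih _ (hn ▸ h2) j l rfl hjl)))
      · exact r.trans (ih _ (hn ▸ h1) i l rfl hil)
          (r.trans (r.symm hr) (r.symm (ih _ (hn ▸ h2) j k rfl hjk)))
  exact fun i j hij => main _ i j rfl hij

/-- The partition into balls of radius `< n`. -/
def ball (n : ℕ) : Setoid I where
  r i j := i = j ∨ d.dist i j < n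
  iseqv :=
    { refl := fun i => Or.inl rfl
      symm := by
        rintro i j (h | h)
        · exact Or.inl h.symm
        · exact Or.inr (d.symm i j ▸ h)
      trans := by
        rintro i j k (rfl | h1) (rfl | h2)
        · exact Or.inl rfl
        · exact Or.inr h2
        · exact Or.inr h1
        · exact Or.inr ((d.ultra i j k).trans_lt (max_lt h1 h2)) }

theorem ball_iff {n : ℕ} {i j : I} : d.ball n i j ↔ i = j ∨ d.dist i j < n := Iff.rfl

theorem valid_ball (n : ℕ) : d.Valid (d.ball n) := by
  intro i j k l hij hkl h1 h2 h
  have h1' := (d.ball_iff.1 h1).resolve_left hij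
  rcases d.binary i j k l hij h with ⟨h3, -⟩ | ⟨h3, -⟩
  · exact d.ball_iff.2 (Or.inr (h3.trans h1'))
  · exact (d.ball n).trans (d.ball_iff.2 (Or.inr (h3.trans h1'))) ((d.ball n).symm h2)

theorem ball_mono : Monotone d.ball := by
  intro m n h i j hij
  rcases d.ball_iff.1 hij with h' | h'
  · exact d.ball_iff.2 (Or.inl h')
  · exact d.ball_iff.2 (Or.inr (h'.trans_le h))

theorem mem_values_ball {n v : ℕ} : v ∈ d.values (d.ball n) ↔ v ∈ d.values ⊤ ∧ v < n := by
  constructor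
  · rintro ⟨i, j, hij, h, rfl⟩
    exact ⟨⟨i, j, hij, trivial, rfl⟩, (d.ball_iff.1 h).resolve_left hij⟩
  · rintro ⟨⟨i, j, hij, -, rfl⟩, h⟩
    exact ⟨i, j, hij, d.ball_iff.2 (Or.inr h), rfl⟩

theorem ball_zero : d.ball 0 = ⊥ := by
  ext i j
  simp [ball_iff]

/-! ### Joins with balls -/

/-- The partition obtained by merging the blocks of `x` and `y`. -/
def merge (r : Setoid I) (x y : I) : Setoid I where
  r i j := r i j ∨ ((r i x ∨ r i y) ∧ (r j x ∨ r j y))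
  iseqv :=
    { refl := fun i => Or.inl (r.refl i)
      symm := by
        rintro i j (h | h)
        · exact Or.inl (r.symm h)
        · exact Or.inr h.symm
      trans := by
        rintro i j k (h1 | h1) (h2 | h2)
        · exact Or.inl (r.trans h1 h2)
        · exact Or.inr ⟨h2.1.imp (r.trans h1) (r.trans h1), h2.2⟩
        · exact Or.inr ⟨h1.1, h1.2.imp (r.trans (r.symm h2)) (r.trans (r.symm h2))⟩
        · exact Or.inr ⟨h1.1, h2.2⟩ }

theorem merge_iff {r : Setoid I} {x y i j : I} :
    merge r x y i j ↔ r i j ∨ ((r i x ∨ r i y) ∧ (r j x ∨ r j y)) := Iff.rfl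

/-- Distances between two blocks that contain the two halves of a ball. -/
theorem dist_of_rel {r : Setoid I} (hr : d.Valid r) {n : ℕ} (hn : d.ball n ≤ r) {x y : I}
    (hxy : x ≠ y) (hd : d.dist x y = n) (hrxy : ¬ r x y) {i j : I} (hi : r i x) (hj : r j y) :
    d.dist i j = n ∨ (j ≠ y ∧ d.dist i j = d.dist j y) ∨ (i ≠ x ∧ d.dist i j = d.dist i x) := by
  have hclose : ∀ a b, d.dist a b < n → r a b := fun a b h => hn (d.ball_iff.2 (Or.inr h))
  have hx := d.dist_self_lt hxy
  have hy := d.dist_self_lt hxy.symm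
  have hyx := d.symm x y
  -- At distance `n` from `x`, the point `i` would lie on the side of `y` in the ball, which would
  -- join the two blocks.
  have hix : d.dist i x ≠ n := by
    intro h
    have hne : i ≠ x := by
      rintro rfl
      omega
    rcases d.binary i x x y hne (h.trans hd.symm) with h1 | h1
    · omega
    · exact hrxy (r.trans (r.symm hi) (hclose i y (h ▸ h1.1)))
  have hjy : d.dist j y ≠ n := by
    intro h
    have hne : j ≠ y := by
      rintro rfl
      omega
    rcases d.binary j y y x hne (h.trans (hd.symm.trans hyx)) with h1 | h1
    · omega
    · exact hrxy (r.trans (r.symm (hclose j x (h ▸ h1.1))) hj)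
  -- Validity of `r`. Now the distances along the path `i, x, y, j` are pairwise different, so the
  -- ultrametric inequality makes `dist i j` their maximum. A self-distance `dist i i` may be
  -- nonzero but is no value, so the cases `i = x` and `j = y` are separate.
  have hne : i ≠ x → j ≠ y → d.dist i x ≠ d.dist j y := fun h1 h2 h =>
    hrxy (r.trans (r.symm hi) (r.trans (hr i x j y h1 h2 hi hj h) hj))
  have e1 := d.ultra i x j
  have e2 := d.ultra x y j
  have e3 := d.ultra x i j
  have e4 := d.ultra x j y
  have e5 := d.ultra i j y
  have e6 := d.ultra i y x
  have e7 := d.ultra i x y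
  have e8 := d.ultra j i y
  have e9 := d.ultra i j x
  have e10 := d.ultra j x y
  have s1 := d.symm i x
  have s2 := d.symm j y
  have s3 := d.symm i j
  have s4 := d.symm j x
  have s5 := d.symm i y
  by_cases h1 : i = x
  · by_cases h2 : j = y
    · subst h1 h2
      exact Or.inl hd
    · subst h1
      simp only [h2, ne_eq, not_false_eq_true, true_and, not_true, false_and, or_false]
      omega
  · by_cases h2 : j = y
    · subst h2
      simp only [h1, ne_eq, not_false_eq_true, true_and, not_true, false_and, false_or]
      omega
    · have := hne h1 h2
      simp only [h1, h2, ne_eq, not_false_eq_true, true_and]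
      omega

/-- All pairs at distance `n` join the same two balls of radius `< n`, so it is enough to merge the
two blocks of `r` containing these balls, if they differ. -/
theorem exists_valid_succ {r : Setoid I} (hr : d.Valid r) {n : ℕ} (hn : d.ball n ≤ r) :
    ∃ s, d.Valid s ∧ r ≤ s ∧ d.ball (n + 1) ≤ s ∧ d.values s ⊆ insert n (d.values r) := by
  have hclose : ∀ a b, d.dist a b < n → r a b := fun a b h => hn (d.ball_iff.2 (Or.inr h))
  have hball : ∀ s : Setoid I, r ≤ s → (∀ i j, i ≠ j → d.dist i j = n → s i j) →
      d.ball (n + 1) ≤ s := by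
    intro s hrs h i j hij
    rcases d.ball_iff.1 hij with rfl | hij
    · exact s.refl i
    rcases Nat.lt_succ_iff_lt_or_eq.1 hij with hij | hij
    · exact hrs (hclose i j hij)
    · by_cases hne : i = j
      · exact hne ▸ s.refl i
      · exact h i j hne hij
  by_cases hex : ∃ x y, x ≠ y ∧ d.dist x y = n
  swap
  · exact ⟨r, hr, le_rfl, hball r le_rfl fun i j h1 h2 => absurd ⟨i, j, h1, h2⟩ hex,
      Set.subset_insert _ _⟩
  obtain ⟨x, y, hxy, hd⟩ := hex
  have hcross : ∀ i j, i ≠ j → d.dist i j = n → (r i x ∧ r j y) ∨ (r i y ∧ r j x) := by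
    intro i j hij h
    rcases d.binary i j x y hij (h.trans hd.symm) with h1 | h1
    · exact Or.inl ⟨hclose _ _ (h ▸ h1.1), hclose _ _ (h ▸ h1.2)⟩
    · exact Or.inr ⟨hclose _ _ (h ▸ h1.1), hclose _ _ (h ▸ h1.2)⟩
  by_cases hrxy : r x y
  · refine ⟨r, hr, le_rfl, hball r le_rfl fun i j h1 h2 => ?_, Set.subset_insert _ _⟩
    rcases hcross i j h1 h2 with ⟨h3, h4⟩ | ⟨h3, h4⟩
    · exact r.trans h3 (r.trans hrxy (r.symm h4))
    · exact r.trans h3 (r.trans (r.symm hrxy) (r.symm h4))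
  have hnot : ∀ i j, i ≠ j → r i j → d.dist i j ≠ n := by
    intro i j hij h h'
    rcases hcross i j hij h' with ⟨h3, h4⟩ | ⟨h3, h4⟩
    · exact hrxy (r.trans (r.symm h3) (r.trans h h4))
    · exact hrxy (r.trans (r.symm h4) (r.trans (r.symm h) h3))
  -- A pair that becomes related has distance `n` or a distance already used in one of the two
  -- merged blocks. This gives both validity and the bound on the values.
  have hpair : ∀ i j, i ≠ j → merge r x y i j → r i j ∨ ((r i x ∨ r i y) ∧
      (d.dist i j = n ∨ ∃ k l, k ≠ l ∧ r k l ∧ (r k x ∨ r k y) ∧ d.dist i j = d.dist k l)) := by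
    intro i j hij h
    have aux : ∀ i j, r i x → r j y → (d.dist i j = n ∨
        ∃ k l, k ≠ l ∧ r k l ∧ (r k x ∨ r k y) ∧ d.dist i j = d.dist k l) := by
      intro i j hi hj
      rcases d.dist_of_rel hr hn hxy hd hrxy hi hj with h | ⟨h, h'⟩ | ⟨h, h'⟩
      · exact Or.inl h
      · exact Or.inr ⟨j, y, h, hj, Or.inr hj, h'⟩
      · exact Or.inr ⟨i, x, h, hi, Or.inl hi, h'⟩
    rcases merge_iff.1 h with h | ⟨h1 | h1, h2 | h2⟩
    · exact Or.inl h
    · exact Or.inl (r.trans h1 (r.symm h2))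
    · exact Or.inr ⟨Or.inl h1, aux i j h1 h2⟩
    · rw [d.symm i j]
      exact Or.inr ⟨Or.inr h1, aux j i h2 h1⟩
    · exact Or.inl (r.trans h1 (r.symm h2))
  refine ⟨merge r x y, ?_, fun i j h => Or.inl h, ?_, ?_⟩
  · intro i j k l hij hkl h1 h2 h
    rw [merge_iff]
    rcases hpair i j hij h1 with h1 | ⟨h1, h1'⟩
    · rcases hpair k l hkl h2 with h2 | ⟨h2, h2' | ⟨k', l', hne, hr', hk', he⟩⟩
      · exact Or.inl (hr i j k l hij hkl h1 h2 h)
      · exact absurd (h.trans h2') (hnot i j hij h1)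
      · have := hr i j k' l' hij hne h1 hr' (h.trans he)
        exact Or.inr ⟨hk'.imp (r.trans this) (r.trans this), h2⟩
    · rcases hpair k l hkl h2 with h2 | ⟨h2, -⟩
      · rcases h1' with h1' | ⟨k', l', hne, hr', hk', he⟩
        · exact absurd (h.symm.trans h1') (hnot k l hkl h2)
        · have := hr k l k' l' hkl hne h2 hr' (h.symm.trans he)
          exact Or.inr ⟨h1, hk'.imp (r.trans this) (r.trans this)⟩
      · exact Or.inr ⟨h1, h2⟩
  · refine hball _ (fun i j h => Or.inl h) fun i j hij h => merge_iff.2 (Or.inr ?_)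
    rcases hcross i j hij h with ⟨h1, h2⟩ | ⟨h1, h2⟩
    · exact ⟨Or.inl h1, Or.inr h2⟩
    · exact ⟨Or.inr h1, Or.inl h2⟩
  · rintro v ⟨i, j, hij, h, rfl⟩
    rcases hpair i j hij h with h | ⟨-, h | ⟨k, l, hkl, hr', -, he⟩⟩
    · exact Or.inr ⟨i, j, hij, h, rfl⟩
    · exact Or.inl h
    · exact Or.inr ⟨k, l, hkl, hr', he.symm⟩

theorem exists_valid_sup {r : Setoid I} (hr : d.Valid r) (n : ℕ) :
    ∃ s, d.Valid s ∧ r ≤ s ∧ d.ball n ≤ s ∧ d.values s ⊆ d.values r ∪ d.values (d.ball n) := by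
  -- The induction uses the cruder bound `v < n`; values of `s` are distances anyway, which recovers
  -- the values of the ball.
  have main : ∃ s, d.Valid s ∧ r ≤ s ∧ d.ball n ≤ s ∧ d.values s ⊆ d.values r ∪ {v | v < n} := by
    induction n with
    | zero => exact ⟨r, hr, le_rfl, by simp [ball_zero], Set.subset_union_left⟩
    | succ n ih =>
      obtain ⟨s, h1, h2, h3, h4⟩ := ih
      obtain ⟨t, h5, h6, h7, h8⟩ := d.exists_valid_succ h1 h3
      refine ⟨t, h5, h2.trans h6, h7, fun v hv => ?_⟩
      rcases h8 hv with rfl | h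
      · exact Or.inr (Nat.lt_succ_self _)
      · exact (h4 h).imp id fun h => Nat.lt_succ_of_lt h
  obtain ⟨s, h1, h2, h3, h4⟩ := main
  refine ⟨s, h1, h2, h3, fun v hv => (h4 hv).imp id fun h => ?_⟩
  exact d.mem_values_ball.2 ⟨d.values_mono le_top hv, h⟩

theorem exists_ball_eq_top [Finite I] : ∃ N, d.ball N = ⊤ := by
  obtain ⟨N, hN⟩ := (Set.finite_range fun p : I × I => d.dist p.1 p.2).bddAbove
  refine ⟨N + 1, top_unique fun i j _ => d.ball_iff.2 (Or.inr ?_)⟩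
  exact Nat.lt_succ_of_le (hN ⟨(i, j), rfl⟩)

/-! ### The lattice of valid partitions -/

/-- A poset that is isomorphic to the poset of the valid partitions is a supersolvable lattice. -/
theorem exists_lattice_isSupersolvable [Finite I] {X : Type*} [PartialOrder X] (ρ : X → Setoid I)
    (hle : ∀ x y, ρ x ≤ ρ y ↔ x ≤ y) (hρ : ∀ x, d.Valid (ρ x))
    (hsurj : ∀ r, d.Valid r → ∃ x, ρ x = r) :
    ∃ L : Lattice X, (∀ x y, L.le x y ↔ x ≤ y) ∧ @IsSupersolvable X L := by
  have : Nonempty X := ⟨(hsurj ⊤ d.valid_top).choose⟩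
  choose! f hf using hsurj
  have hval : ∀ S : Set X, d.Valid (sInf (ρ '' S)) := by
    refine fun S => d.valid_sInf _ ?_
    rintro _ ⟨x, -, rfl⟩
    exact hρ x
  let : InfSet X := ⟨fun S => f (sInf (ρ '' S))⟩
  have hglb : ∀ S : Set X, IsGLB S (sInf S) := by
    intro S
    have h : ρ (sInf S) = sInf (ρ '' S) := hf _ (hval S)
    refine ⟨fun x hx => (hle _ _).1 (h ▸ sInf_le ⟨x, hx, rfl⟩), fun x hx => (hle _ _).1 ?_⟩
    rw [h]
    refine le_sInf ?_
    rintro _ ⟨y, hy, rfl⟩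
    exact (hle _ _).2 (hx hy)
  let CL : CompleteLattice X := completeLatticeOfInf X hglb
  have hle' : ∀ x y : X, ρ x ≤ ρ y ↔ x ≤ y := hle
  have hmono : Monotone ρ := fun x y h => (hle' x y).2 h
  have hinj : Function.Injective ρ := fun x y h =>
    le_antisymm ((hle' x y).1 h.le) ((hle' y x).1 h.ge)
  have : Finite (Setoid I) :=
    Finite.of_injective (fun r : Setoid I => (r : I → I → Prop)) fun r s h =>
      Setoid.ext fun i j => by rw [show r i j = s i j from congrFun (congrFun h i) j]
  have : Finite X := Finite.of_injective ρ hinj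
  refine ⟨inferInstance, fun _ _ => Iff.rfl, ?_⟩
  have hball : ∀ n, ρ (f (d.ball n)) = d.ball n := fun n => hf _ (d.valid_ball n)
  have hvb : d.Valid (⊥ : Setoid I) := d.ball_zero ▸ d.valid_ball 0
  have hbot : f ⊥ = ⊥ := le_bot_iff.1 ((hle' _ _).1 (by rw [hf _ hvb]; exact bot_le))
  have htop : f ⊤ = ⊤ := top_le_iff.1 ((hle' _ _).1 (by rw [hf _ d.valid_top]; exact le_top))
  obtain ⟨N, hN⟩ := d.exists_ball_eq_top
  refine isSupersolvable_of_strictMono (V := fun x => d.values (ρ x))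
    (m := fun n => f (d.ball n)) (N := N) (d.values_mono.comp hmono) ?_ ?_ ?_ ?_ ?_ ?_ ?_ ?_
  · exact fun x y hxy h => (hle' _ _).1 (d.le_of_values_subset (hmono hxy) (hρ y) h)
  · simp only [← hbot, hf _ hvb, values_bot]
  · intro a b h
    refine (hle' _ _).1 ?_
    simp only [hball]
    exact d.ball_mono h
  · simp only [ball_zero, hbot]
  · simp only [hN, htop]
  · intro k v hv
    simp only [hball, mem_values_ball, Set.mem_insert_iff] at hv ⊢
    rcases Nat.lt_succ_iff_lt_or_eq.1 hv.2 with h | h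
    · exact Or.inr ⟨hv.1, h⟩
    · exact Or.inl h
  · rintro x k v ⟨⟨i, j, hij, h, rfl⟩, hv⟩
    simp only [hball, mem_values_ball] at hv
    have h1 : d.Valid (ρ x ⊓ d.ball k) := fun a b a' b' hab hab' r1 r2 he =>
      ⟨hρ x a b a' b' hab hab' r1.1 r2.1 he, d.valid_ball k a b a' b' hab hab' r1.2 r2.2 he⟩
    have h2 : f (ρ x ⊓ d.ball k) ≤ x ⊓ f (d.ball k) :=
      le_inf ((hle' _ _).1 (by rw [hf _ h1]; exact inf_le_left))
        ((hle' _ _).1 (by rw [hf _ h1, hball]; exact inf_le_right))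
    have h3 := (hle' _ _).2 h2
    rw [hf _ h1] at h3
    exact ⟨i, j, hij, h3 ⟨h, d.ball_iff.2 (Or.inr hv.2)⟩, rfl⟩
  · intro x k
    -- The join is not computed: any valid upper bound with few enough values bounds its values.
    obtain ⟨s, h1, h2, h3, h4⟩ := d.exists_valid_sup (hρ x) k
    have h5 : x ⊔ f (d.ball k) ≤ f s :=
      sup_le ((hle' _ _).1 (by rw [hf _ h1]; exact h2))
        ((hle' _ _).1 (by rw [hf _ h1, hball]; exact h3))
    have h6 := (hle' _ _).2 h5
    rw [hf _ h1] at h6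
    simp only [hball]
    exact (d.values_mono h6).trans h4

end BinaryUltrametric
-- Forests, their partitions into trees, and meeting vertices
namespace Forest

section

variable {I : Type*} [DecidableEq I] (F : Forest I)

theorem subset_or_subset {v w : Finset I} (hv : v ∈ F.verts) (hw : w ∈ F.verts) {i : I}
    (h1 : i ∈ v) (h2 : i ∈ w) : v ⊆ w ∨ w ⊆ v := by
  rcases F.laminar v hv w hw with h | h | h
  · exact Or.inl h
  · exact Or.inr h
  · exact absurd h2 (Finset.disjoint_left.1 h h1)

/-- The partition of the labels into the trees of a forest. -/
def trees : Setoid I where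
  r i j := ∃ v ∈ F.verts, i ∈ v ∧ j ∈ v
  iseqv :=
    { refl := fun i => ⟨{i}, F.leaf_mem i, by simp, by simp⟩
      symm := by
        rintro i j ⟨v, hv, h1, h2⟩
        exact ⟨v, hv, h2, h1⟩
      trans := by
        rintro i j k ⟨v, hv, h1, h2⟩ ⟨w, hw, h3, h4⟩
        rcases F.subset_or_subset hv hw h2 h3 with h | h
        · exact ⟨w, hw, h h1, h4⟩
        · exact ⟨v, hv, h1, h h4⟩ }

theorem trees_iff {i j : I} : F.trees i j ↔ ∃ v ∈ F.verts, i ∈ v ∧ j ∈ v := Iff.rfl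

theorem trees_of_mem {v : Finset I} (hv : v ∈ F.verts) {i j : I} (hi : i ∈ v) (hj : j ∈ v) :
    F.trees i j := ⟨v, hv, hi, hj⟩

theorem isInner_iff {v : F.Vertex} : IsInner v ↔ ∀ i, v.1 ≠ {i} := by
  simp only [IsInner, leaf, ne_eq, Subtype.ext_iff]

theorem covBy_of_union_eq {a b v : F.Vertex} (hab : Disjoint a.1 b.1) (hu : a.1 ∪ b.1 = v.1) :
    a ⋖ v := by
  obtain ⟨j, hj⟩ := F.nonempty b b.2
  have hle : a ≤ v := show a.1 ⊆ v.1 from hu ▸ Finset.subset_union_left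
  refine ⟨lt_of_le_of_ne hle ?_, fun c hac hcv => ?_⟩
  · rintro rfl
    exact Finset.disjoint_left.1 hab (hu ▸ Finset.mem_union_right _ hj) hj
  · have hac' : a.1 ⊂ c.1 := hac
    obtain ⟨k, hk, hka⟩ := Finset.exists_of_ssubset hac'
    have hkb : k ∈ b.1 := by
      have : k ∈ a.1 ∪ b.1 := hu ▸ (show c.1 ⊆ v.1 from hcv.le) hk
      exact (Finset.mem_union.1 this).resolve_left hka
    rcases F.subset_or_subset c.2 b.2 hk hkb with h | h
    · obtain ⟨i, hi⟩ := F.nonempty a a.2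
      exact Finset.disjoint_left.1 hab hi (h (hac'.1 hi))
    · refine hcv.not_ge (show v.1 ⊆ c.1 from ?_)
      rw [← hu]
      exact Finset.union_subset hac'.1 h

theorem IsForestMap.trees_le {F G : Forest I} {φ : F.Vertex → G.Vertex} (hφ : IsForestMap φ) :
    F.trees ≤ G.trees := by
  rintro i j ⟨v, hv, h1, h2⟩
  exact ⟨_, (φ ⟨v, hv⟩).2, hφ.subset ⟨v, hv⟩ h1, hφ.subset ⟨v, hv⟩ h2⟩

variable [Fintype I]

/-- The vertex where the paths from `i` and `j` to the root meet. -/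
def meetVertex (i j : I) : Finset I :=
  Finset.univ.filter fun k => ∀ v ∈ F.verts, i ∈ v → j ∈ v → k ∈ v

theorem mem_meetVertex {i j k : I} :
    k ∈ F.meetVertex i j ↔ ∀ v ∈ F.verts, i ∈ v → j ∈ v → k ∈ v := by
  simp [meetVertex]

theorem left_mem_meetVertex (i j : I) : i ∈ F.meetVertex i j :=
  F.mem_meetVertex.2 fun _ _ h _ => h

theorem right_mem_meetVertex (i j : I) : j ∈ F.meetVertex i j :=
  F.mem_meetVertex.2 fun _ _ _ h => h

theorem meetVertex_subset {v : Finset I} (hv : v ∈ F.verts) {i j : I} (hi : i ∈ v)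
    (hj : j ∈ v) : F.meetVertex i j ⊆ v := fun _ hk => F.mem_meetVertex.1 hk v hv hi hj

theorem meetVertex_comm (i j : I) : F.meetVertex i j = F.meetVertex j i := by
  ext k
  simp only [mem_meetVertex]
  exact ⟨fun h v hv h1 h2 => h v hv h2 h1, fun h v hv h1 h2 => h v hv h2 h1⟩

theorem meetVertex_self (i : I) : F.meetVertex i i = {i} :=
  (F.meetVertex_subset (F.leaf_mem i) (by simp) (by simp)).antisymm
    (by simpa using F.left_mem_meetVertex i i)

theorem meetVertex_mem {i j : I} (h : F.trees i j) : F.meetVertex i j ∈ F.verts := by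
  obtain ⟨v, hv, h1, h2⟩ := h
  obtain ⟨m, hm, hmin⟩ := (F.verts.filter fun v => i ∈ v ∧ j ∈ v).exists_minimal
    ⟨v, by simp [hv, h1, h2]⟩
  simp only [Finset.mem_filter] at hm hmin
  obtain ⟨hm, him, hjm⟩ := hm
  have : F.meetVertex i j = m := by
    refine (F.meetVertex_subset hm him hjm).antisymm fun k hk => F.mem_meetVertex.2 ?_
    intro w hw h3 h4
    rcases F.subset_or_subset hm hw him h3 with h | h
    · exact h hk
    · exact hmin ⟨hw, h3, h4⟩ h hk
  exact this ▸ hm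

theorem mem_meetVertex_trees {i j k : I} (h : F.trees i j) (hk : k ∈ F.meetVertex i j) :
    F.trees i k := F.trees_of_mem (F.meetVertex_mem h) (F.left_mem_meetVertex i j) hk

/-- By minimality of the meeting vertex, neither of its children contains both `i` and `j`. -/
theorem exists_children {i j : I} (hij : i ≠ j) (h : F.trees i j) :
    ∃ a ∈ F.verts, ∃ b ∈ F.verts, Disjoint a b ∧ a ∪ b = F.meetVertex i j ∧ i ∈ a ∧ j ∈ b := by
  have hi := F.left_mem_meetVertex i j
  have hj := F.right_mem_meetVertex i j
  obtain ⟨a, ha, b, hb, hab, hu⟩ := F.binary _ (F.meetVertex_mem h)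
    (Finset.one_lt_card.2 ⟨i, hi, j, hj, hij⟩)
  have key : ∀ a b : Finset I, a ∈ F.verts → b ∈ F.verts → Disjoint a b →
      a ∪ b = F.meetVertex i j → i ∈ a → j ∈ b := by
    intro a b ha hb hab hu hia
    by_contra hjb
    have hja : j ∈ a := by
      rw [← hu, Finset.mem_union] at hj
      exact hj.resolve_right hjb
    obtain ⟨k, hk⟩ := F.nonempty b hb
    have h1 : k ∈ a := F.meetVertex_subset ha hia hja (hu ▸ Finset.mem_union_right a hk)
    exact Finset.disjoint_left.1 hab h1 hk
  rw [← hu, Finset.mem_union] at hi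
  rcases hi with hi | hi
  · exact ⟨a, ha, b, hb, hab, hu, hi, key a b ha hb hab hu hi⟩
  · have hu' : b ∪ a = F.meetVertex i j := by rw [Finset.union_comm, hu]
    exact ⟨b, hb, a, ha, hab.symm, hu', hi, key b a hb ha hab.symm hu' hi⟩

/-- Pick one leaf below each child, or the same leaf twice if `v` is a leaf. -/
theorem exists_meetVertex_eq {v : Finset I} (hv : v ∈ F.verts) :
    ∃ i ∈ v, ∃ j ∈ v, F.meetVertex i j = v := by
  rcases Nat.lt_or_ge v.card 2 with h | h
  · have h1 : v.card = 1 := by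
      have := Finset.card_pos.2 (F.nonempty v hv)
      omega
    obtain ⟨i, rfl⟩ := Finset.card_eq_one.1 h1
    exact ⟨i, by simp, i, by simp, F.meetVertex_self i⟩
  · obtain ⟨a, ha, b, hb, hab, hu⟩ := F.binary v hv h
    obtain ⟨i, hi⟩ := F.nonempty a ha
    obtain ⟨j, hj⟩ := F.nonempty b hb
    have hiv : i ∈ v := hu ▸ Finset.mem_union_left b hi
    have hjv : j ∈ v := hu ▸ Finset.mem_union_right a hj
    refine ⟨i, hiv, j, hjv, (F.meetVertex_subset hv hiv hjv).antisymm ?_⟩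
    have hm := F.meetVertex_mem (F.trees_of_mem hv hiv hjv)
    rw [← hu]
    refine Finset.union_subset ?_ ?_
    · rcases F.subset_or_subset hm ha (F.left_mem_meetVertex i j) hi with h | h
      · exact absurd hj (Finset.disjoint_left.1 hab (h (F.right_mem_meetVertex i j)))
      · exact h
    · rcases F.subset_or_subset hm hb (F.right_mem_meetVertex i j) hj with h | h
      · exact absurd (h (F.left_mem_meetVertex i j)) (Finset.disjoint_left.1 hab hi)
      · exact h

/-- The vertex `meetVertex i j` of a tree of `F`. -/
def meet {i j : I} (h : F.trees i j) : F.Vertex := ⟨F.meetVertex i j, F.meetVertex_mem h⟩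

variable {F} {G : Forest I}

/-- The image of the vertex where two paths meet is the vertex where their images meet. -/
theorem IsForestMap.map_meet {φ : F.Vertex → G.Vertex} (hφ : IsForestMap φ) {i j : I}
    (h : F.trees i j) : φ (F.meet h) = G.meet (hφ.trees_le h) := by
  by_cases hij : i = j
  · subst hij
    have h1 : F.meet h = F.leaf i := Subtype.ext (F.meetVertex_self i)
    have h2 : G.meet (hφ.trees_le h) = G.leaf i := Subtype.ext (G.meetVertex_self i)
    rw [h1, h2, hφ.leaf]
  obtain ⟨a, ha, b, hb, hab, hu, hia, hjb⟩ := F.exists_children hij h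
  set v := F.meet h
  set z := G.meet (hφ.trees_le h)
  set a' : F.Vertex := ⟨a, ha⟩
  set b' : F.Vertex := ⟨b, hb⟩
  have hav : a' ⋖ v := F.covBy_of_union_eq (a := a') (b := b') hab hu
  have hbv : b' ⋖ v := F.covBy_of_union_eq (a := b') (b := a') hab.symm
    (by rw [Finset.union_comm]; exact hu)
  have hne : a' ≠ b' := by
    intro he
    have he' : a = b := congrArg Subtype.val he
    exact Finset.disjoint_left.1 hab hia (he' ▸ hia)
  have hdisj := Set.disjoint_left.1
    (hφ.tree_disjoint a' v b' v hav hbv ⟨v, le_rfl, le_rfl⟩ hne)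
  have hlt : ∀ x, x < v → φ x < φ v := fun x hx =>
    lt_of_le_of_ne (hφ.monotone hx.le) fun he => hx.ne (hφ.injective he)
  have hi1 : i ∈ (φ a').1 := hφ.subset a' hia
  have hj1 : j ∈ (φ b').1 := hφ.subset b' hjb
  -- If the images of the children shared a leaf they would be nested, and the larger would lie on
  -- both image paths. As they are disjoint, both lie below `z`, which would be common to the paths
  -- unless `z = φ v`.
  have hcommon : ∀ k, k ∈ (φ a').1 → k ∈ (φ b').1 → False := by
    intro k h1 h2
    rcases G.subset_or_subset (φ a').2 (φ b').2 h1 h2 with h3 | h3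
    · exact hdisj (a := φ b') ⟨h3, hlt _ hbv.lt⟩ ⟨le_rfl, hlt _ hbv.lt⟩
    · exact hdisj (a := φ a') ⟨le_rfl, hlt _ hav.lt⟩ ⟨h3, hlt _ hav.lt⟩
  have hzi : i ∈ z.1 := G.left_mem_meetVertex i j
  have hzj : j ∈ z.1 := G.right_mem_meetVertex i j
  have hza : φ a' ≤ z := by
    rcases G.subset_or_subset (φ a').2 z.2 hi1 hzi with h3 | h3
    · exact h3
    · exact (hcommon j (h3 hzj) hj1).elim
  have hzb : φ b' ≤ z := by
    rcases G.subset_or_subset (φ b').2 z.2 hj1 hzj with h3 | h3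
    · exact h3
    · exact (hcommon i hi1 (h3 hzi)).elim
  have hzv : z ≤ φ v := G.meetVertex_subset (φ v).2
    (hφ.subset v (F.left_mem_meetVertex i j)) (hφ.subset v (F.right_mem_meetVertex i j))
  rcases hzv.lt_or_eq with h3 | h3
  · exact (hdisj ⟨hza, h3⟩ ⟨hzb, h3⟩).elim
  · exact h3.symm

/-! ### The order in terms of partitions and meeting vertices -/

/-- A forest map exists if the trees of `F` lie in trees of `G`, paths meet in the same way in
`F` and in `G`, and different trees of `F` use different inner vertices of `G`. -/
theorem le_of_trees_le (h1 : F.trees ≤ G.trees)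
    (h2 : ∀ i j k, F.trees i j → F.trees i k → (k ∈ F.meetVertex i j ↔ k ∈ G.meetVertex i j))
    (h3 : ∀ i j k l, i ≠ j → k ≠ l → F.trees i j → F.trees k l →
      G.meetVertex i j = G.meetVertex k l → F.trees i k) : F ≤ G := by
  have hsub : ∀ i j, F.trees i j → F.meetVertex i j ⊆ G.meetVertex i j := fun i j hij k hk =>
    (h2 i j k hij (F.mem_meetVertex_trees hij hk)).1 hk
  have hex : ∀ v : F.Vertex, ∃ w : G.Vertex, ∃ i ∈ v.1, ∃ j ∈ v.1,
      F.meetVertex i j = v.1 ∧ w.1 = G.meetVertex i j := by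
    rintro ⟨v, hv⟩
    obtain ⟨i, hi, j, hj, he⟩ := F.exists_meetVertex_eq hv
    exact ⟨G.meet (h1 (F.trees_of_mem hv hi hj)), i, hi, j, hj, he, rfl⟩
  choose φ hφ using hex
  have hle : ∀ v, v.1 ⊆ (φ v).1 := by
    intro v
    obtain ⟨i, hi, j, hj, he, he'⟩ := hφ v
    rw [he', ← he]
    exact hsub i j (F.trees_of_mem v.2 hi hj)
  -- So `φ v` is the smallest vertex of `G` containing `v`, whatever leaves were chosen.
  have hmin : ∀ v (u : G.Vertex), v.1 ⊆ u.1 → φ v ≤ u := by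
    intro v u hu
    obtain ⟨i, hi, j, hj, he, he'⟩ := hφ v
    change (φ v).1 ⊆ u.1
    rw [he']
    exact G.meetVertex_subset u.2 (hu hi) (hu hj)
  have hmem : ∀ v i k, i ∈ v.1 → F.trees i k → k ∈ (φ v).1 → k ∈ v.1 := by
    intro v i' k hi' hk hkφ
    obtain ⟨i, hi, j, hj, he, he'⟩ := hφ v
    rw [← he]
    rw [he'] at hkφ
    exact (h2 i j k (F.trees_of_mem v.2 hi hj)
      (F.trees.trans (F.trees_of_mem v.2 hi hi') hk)).2 hkφ
  have hinj : ∀ v w i j, i ∈ v.1 → j ∈ w.1 → F.trees i j → φ v = φ w → v = w := by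
    intro v w i j hi hj hij he
    refine Subtype.ext (Finset.Subset.antisymm (fun k hk => ?_) fun k hk => ?_)
    · exact hmem w j k hj (F.trees.trans (F.trees.symm hij) (F.trees_of_mem v.2 hi hk))
        (he ▸ hle v hk)
    · exact hmem v i k hi (F.trees.trans hij (F.trees_of_mem w.2 hj hk)) (he ▸ hle w hk)
  refine ⟨φ, ⟨fun v w hvw => hmin v _ (Finset.Subset.trans hvw (hle w)), ?_, ?_, ?_, ?_, ?_⟩⟩
  · intro v hv
    rw [isInner_iff] at hv ⊢
    intro i hi
    have := hle v
    rw [hi] at this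
    rcases Finset.subset_singleton_iff.1 this with h | h
    · exact (F.nonempty v v.2).ne_empty h
    · exact hv i h
  · intro v w hv hw he
    obtain ⟨i, hi, j, hj, hv1, hv2⟩ := hφ v
    obtain ⟨k, hk, l, hl, hw1, hw2⟩ := hφ w
    have hij : i ≠ j := by
      rintro rfl
      exact F.isInner_iff.1 hv i (hv1 ▸ F.meetVertex_self i)
    have hkl : k ≠ l := by
      rintro rfl
      exact F.isInner_iff.1 hw k (hw1 ▸ F.meetVertex_self k)
    refine hinj v w i k hi hk (h3 i j k l hij hkl (F.trees_of_mem v.2 hi hj)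
      (F.trees_of_mem w.2 hk hl) ?_) he
    rw [← hv2, ← hw2, he]
  · intro i
    refine le_antisymm (hmin _ _ subset_rfl) ?_
    exact Finset.singleton_subset_iff.2 (hle (F.leaf i) (Finset.mem_singleton_self i))
  · rintro v w ⟨r, hv, hw⟩ he
    obtain ⟨i, hi⟩ := F.nonempty v v.2
    obtain ⟨j, hj⟩ := F.nonempty w w.2
    exact hinj v w i j hi hj (F.trees_of_mem r.2 (hv hi) (hw hj)) he
  · rintro v p w q hvp hwq ⟨r, hp, hq⟩ hne
    rw [Set.disjoint_left]
    rintro u ⟨hu1, hu2⟩ ⟨hu3, hu4⟩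
    -- A point on the image of an edge, other than its upper end, contains no vertex strictly above
    -- the start of the edge. Disjoint starts `v, w` violate this through their meeting vertex.
    have hup : ∀ x y : F.Vertex, x ⋖ y → u < φ y → ∀ z : F.Vertex, x < z → z.1 ⊆ u.1 → False := by
      intro x y hxy huy z hxz hzu
      obtain ⟨i, hi⟩ := F.nonempty x x.2
      have hyz : y ≤ z := by
        rcases F.subset_or_subset y.2 z.2 (hxy.le hi) (hxz.le hi) with h | h
        · exact h
        · rcases (show z ≤ y from h).lt_or_eq with h | h
          · exact absurd h (hxy.2 hxz)
          · exact h.ge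
      exact huy.not_ge (hmin y u (Finset.Subset.trans hyz hzu))
    have hvu : v.1 ⊆ u.1 := Finset.Subset.trans (hle v) hu1
    have hwu : w.1 ⊆ u.1 := Finset.Subset.trans (hle w) hu3
    rcases F.laminar v v.2 w w.2 with h | h | h
    · exact hup v p hvp hu2 w (lt_of_le_of_ne h hne) hwu
    · exact hup w q hwq hu4 v (lt_of_le_of_ne h hne.symm) hvu
    · obtain ⟨i, hi⟩ := F.nonempty v v.2
      obtain ⟨j, hj⟩ := F.nonempty w w.2
      have hij : F.trees i j := F.trees_of_mem r.2 (hp (hvp.le hi)) (hq (hwq.le hj))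
      have hz : (F.meet hij).1 ⊆ u.1 :=
        (hsub i j hij).trans (G.meetVertex_subset u.2 (hvu hi) (hwu hj))
      refine hup v p hvp hu2 (F.meet hij) ?_ hz
      have hjz : j ∈ (F.meet hij).1 := F.right_mem_meetVertex i j
      have hjv : j ∉ v.1 := fun hjv => Finset.disjoint_left.1 h hjv hj
      rcases F.subset_or_subset v.2 (F.meet hij).2 hi (F.left_mem_meetVertex i j) with h' | h'
      · exact lt_of_le_of_ne h' fun he => hjv (by rw [he]; exact hjz)
      · exact absurd (h' hjz) hjv

theorem le_iff : F ≤ G ↔ F.trees ≤ G.trees ∧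
    (∀ i j k, F.trees i j → F.trees i k → (k ∈ F.meetVertex i j ↔ k ∈ G.meetVertex i j)) ∧
    ∀ i j k l, i ≠ j → k ≠ l → F.trees i j → F.trees k l →
      G.meetVertex i j = G.meetVertex k l → F.trees i k := by
  constructor
  · rintro ⟨φ, hφ⟩
    have hmap : ∀ {i j : I} (h : F.trees i j), (φ (F.meet h)).1 = G.meetVertex i j :=
      fun h => congrArg Subtype.val (hφ.map_meet h)
    refine ⟨hφ.trees_le, fun i j k hij hik => ⟨fun hk => ?_, fun hk => ?_⟩, ?_⟩
    · rw [← hmap hij]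
      exact hφ.subset _ hk
    · by_contra hk'
      -- If `k` is not below the meeting vertex of `i, j` in `F`, that of `i, k` is strictly higher,
      -- yet both have the same image.
      have hle : F.meet hij ≤ F.meet hik := by
        rcases F.subset_or_subset (F.meet hij).2 (F.meet hik).2 (F.left_mem_meetVertex i j)
          (F.left_mem_meetVertex i k) with h | h
        · exact h
        · exact absurd (h (F.right_mem_meetVertex i k)) hk'
      have hge : φ (F.meet hik) ≤ φ (F.meet hij) := by
        rw [hφ.map_meet hij, hφ.map_meet hik]
        exact G.meetVertex_subset (G.meetVertex_mem (hφ.trees_le hij))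
          (G.left_mem_meetVertex i j) hk
      have he := hφ.injective (le_antisymm (hφ.monotone hle) hge)
      apply hk'
      have : F.meetVertex i j = F.meetVertex i k := congrArg Subtype.val he
      rw [this]
      exact F.right_mem_meetVertex i k
    · intro i j k l _ _ hij hkl h
      have he : F.meet hij = F.meet hkl := by
        refine hφ.injective (Subtype.ext ?_)
        rw [hmap hij, hmap hkl, h]
      have he' : F.meetVertex i j = F.meetVertex k l := congrArg Subtype.val he
      exact F.mem_meetVertex_trees hij (he' ▸ F.left_mem_meetVertex k l)
  · rintro ⟨h1, h2, h3⟩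
    exact le_of_trees_le h1 h2 h3

theorem zero_trees {i j : I} : (zero I).trees i j ↔ i = j := by
  constructor
  · rintro ⟨v, hv, h1, h2⟩
    simp only [zero, Finset.mem_image, Finset.mem_univ, true_and] at hv
    obtain ⟨k, rfl⟩ := hv
    rw [Finset.mem_singleton] at h1 h2
    exact h1.trans h2.symm
  · rintro rfl
    exact (zero I).trees.refl i

theorem zero_le (F : Forest I) : zero I ≤ F := by
  refine le_of_trees_le (fun i j h => zero_trees.1 h ▸ F.trees.refl i) ?_ ?_
  · intro i j k hij hik
    obtain rfl := zero_trees.1 hij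
    obtain rfl := zero_trees.1 hik
    simp [meetVertex_self]
  · intro i j k l hij _ h
    exact absurd (zero_trees.1 h) hij

/-- Below a given forest the order is the refinement of the partitions into trees. -/
theorem trees_le_trees_iff {T : Forest I} (hF : F ≤ T) (hG : G ≤ T) :
    F.trees ≤ G.trees ↔ F ≤ G := by
  refine ⟨fun h => ?_, fun h => (le_iff.1 h).1⟩
  obtain ⟨f1, f2, f3⟩ := le_iff.1 hF
  obtain ⟨g1, g2, g3⟩ := le_iff.1 hG
  refine le_of_trees_le h (fun i j k hij hik => ?_) fun i j k l hij hkl h1 h2 he => ?_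
  · rw [f2 i j k hij hik, g2 i j k (h hij) (h hik)]
  · have hsub : ∀ i j k l, F.trees i j → F.trees k l → G.meetVertex i j = G.meetVertex k l →
        T.meetVertex k l ⊆ T.meetVertex i j := by
      intro i j k l h1 h2 he
      have hk : k ∈ G.meetVertex i j := he ▸ G.left_mem_meetVertex k l
      have hl : l ∈ G.meetVertex i j := he ▸ G.right_mem_meetVertex k l
      exact T.meetVertex_subset (T.meetVertex_mem (f1 h1))
        ((g2 i j k (h h1) (G.mem_meetVertex_trees (h h1) hk)).1 hk)
        ((g2 i j l (h h1) (G.mem_meetVertex_trees (h h1) hl)).1 hl)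
    exact f3 i j k l hij hkl h1 h2
      ((hsub k l i j h2 h1 he.symm).antisymm (hsub i j k l h1 h2 he))

/-! ### Restriction of a tree to the blocks of a partition -/

open Classical in
/-- The restrictions of a forest to the blocks of a partition. -/
noncomputable def restrict (T : Forest I) (r : Setoid I) : Forest I where
  verts := (T.verts ×ˢ Finset.univ).image (fun p => p.1.filter fun j => r p.2 j) |>.filter
    Finset.Nonempty
  nonempty v hv := (Finset.mem_filter.1 hv).2
  leaf_mem i := by
    simp only [Finset.mem_filter, Finset.mem_image, Finset.mem_product, Finset.mem_univ, and_true,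
      Prod.exists, Finset.singleton_nonempty]
    refine ⟨{i}, i, T.leaf_mem i, ?_⟩
    ext j
    simp only [Finset.mem_filter, Finset.mem_singleton, and_iff_left_iff_imp]
    rintro rfl
    exact r.refl j
  laminar := by
    simp only [Finset.mem_filter, Finset.mem_image, Finset.mem_product, Finset.mem_univ, and_true,
      Prod.exists]
    rintro _ ⟨⟨v, i, hv, rfl⟩, -⟩ _ ⟨⟨w, j, hw, rfl⟩, -⟩
    by_cases hij : r i j
    · rcases T.laminar v hv w hw with h | h | h
      · left
        intro k hk
        rw [Finset.mem_filter] at hk ⊢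
        exact ⟨h hk.1, r.trans (r.symm hij) hk.2⟩
      · right; left
        intro k hk
        rw [Finset.mem_filter] at hk ⊢
        exact ⟨h hk.1, r.trans hij hk.2⟩
      · right; right
        exact Finset.disjoint_filter_filter h
    · right; right
      rw [Finset.disjoint_left]
      intro k h1 h2
      rw [Finset.mem_filter] at h1 h2
      exact hij (r.trans h1.2 (r.symm h2.2))
  binary := by
    simp only [Finset.mem_filter, Finset.mem_image, Finset.mem_product, Finset.mem_univ, and_true,
      Prod.exists]
    rintro _ ⟨⟨v, i, hv, rfl⟩, -⟩
    -- Descend from `v` while only one child meets the block: the trace on the block does not change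
    -- until both do.
    induction v using Finset.strongInduction with
    | _ v ih =>
      intro hcard
      obtain ⟨a, ha, b, hb, hab, hu⟩ := T.binary v hv
        (hcard.trans (Finset.card_le_card (Finset.filter_subset _ _)))
      have hsub : ∀ a b : Finset I, b ∈ T.verts → Disjoint a b → a ∪ b = v → a ⊂ v := by
        intro a b hb hab hu
        obtain ⟨k, hk⟩ := T.nonempty b hb
        refine ⟨hu ▸ Finset.subset_union_left, fun h => ?_⟩
        exact Finset.disjoint_left.1 hab (h (hu ▸ Finset.mem_union_right a hk)) hk
      have hfu : (a.filter fun j => r i j) ∪ (b.filter fun j => r i j) =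
          v.filter fun j => r i j := by
        rw [← Finset.filter_union, hu]
      by_cases ha' : (a.filter fun j => r i j).Nonempty
      · by_cases hb' : (b.filter fun j => r i j).Nonempty
        · exact ⟨_, ⟨⟨a, i, ha, rfl⟩, ha'⟩, _, ⟨⟨b, i, hb, rfl⟩, hb'⟩,
            Finset.disjoint_filter_filter hab, hfu⟩
        · rw [Finset.not_nonempty_iff_eq_empty.1 hb', Finset.union_empty] at hfu
          rw [← hfu] at hcard ⊢
          exact ih a (hsub a b hb hab hu) ha hcard
      · rw [Finset.not_nonempty_iff_eq_empty.1 ha', Finset.empty_union] at hfu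
        rw [← hfu] at hcard ⊢
        exact ih b (hsub b a ha hab.symm (by rw [Finset.union_comm, hu])) hb hcard

theorem mem_restrict_verts {T : Forest I} {r : Setoid I} {w : Finset I} :
    w ∈ (T.restrict r).verts ↔
      ∃ v ∈ T.verts, ∃ i ∈ v, ∀ j, j ∈ w ↔ j ∈ v ∧ r i j := by
  classical
  simp only [restrict, Finset.mem_filter, Finset.mem_image, Finset.mem_product, Finset.mem_univ,
    and_true, Prod.exists]
  constructor
  · rintro ⟨⟨v, i, hv, rfl⟩, ⟨k, hk⟩⟩
    rw [Finset.mem_filter] at hk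
    refine ⟨v, hv, k, hk.1, fun j => ?_⟩
    rw [Finset.mem_filter]
    exact and_congr_right fun _ => ⟨fun h => r.trans (r.symm hk.2) h, fun h => r.trans hk.2 h⟩
  · rintro ⟨v, hv, i, hi, h⟩
    refine ⟨⟨v, i, hv, ?_⟩, ⟨i, (h i).2 ⟨hi, r.refl i⟩⟩⟩
    ext j
    rw [h, Finset.mem_filter]

theorem restrict_trees {T : Forest I} (hT : ∀ i j, T.trees i j) (r : Setoid I) :
    (T.restrict r).trees = r := by
  ext i j
  rw [trees_iff]
  constructor
  · rintro ⟨w, hw, h1, h2⟩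
    obtain ⟨v, -, k, -, h⟩ := mem_restrict_verts.1 hw
    exact r.trans (r.symm ((h i).1 h1).2) ((h j).1 h2).2
  · intro hij
    classical
    obtain ⟨v, hv, hi, hj⟩ := hT i j
    exact ⟨v.filter fun k => r i k, mem_restrict_verts.2 ⟨v, hv, i, hi, by simp⟩,
      by simp [hi], by simpa [hj] using hij⟩

theorem mem_restrict_meetVertex {T : Forest I} {r : Setoid I} {i j k : I} (hij : r i j)
    (hik : r i k) : k ∈ (T.restrict r).meetVertex i j ↔ k ∈ T.meetVertex i j := by
  classical
  rw [mem_meetVertex, mem_meetVertex]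
  constructor
  · intro h v hv hi hj
    have := h (v.filter fun k => r i k) (mem_restrict_verts.2 ⟨v, hv, i, hi, by simp⟩)
      (by simp [hi]) (by simpa [hj] using hij)
    exact (Finset.mem_filter.1 this).1
  · intro h w hw hi hj
    obtain ⟨v, hv, m, hm, hw⟩ := mem_restrict_verts.1 hw
    rw [hw] at hi hj ⊢
    exact ⟨h v hv hi.1 hj.1, r.trans hi.2 hik⟩

end

/-! ### Numbering the vertices, and the conclusion -/

theorem exists_injective_strictMono (α : Type*) [Finite α] [PartialOrder α] :
    ∃ p : α → ℕ, Function.Injective p ∧ StrictMono p := by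
  have : Fintype (LinearExtension α) := Fintype.ofFinite α
  let e := (Fintype.orderIsoFinOfCardEq (LinearExtension α) rfl).symm
  have hinj : Function.Injective fun x : α => (e (toLinearExtension x) : ℕ) :=
    fun x y h => e.injective (Fin.ext h)
  have hmono : Monotone fun x : α => (e (toLinearExtension x) : ℕ) :=
    fun x y h => e.monotone (toLinearExtension.monotone h)
  exact ⟨_, hinj, hmono.strictMono_of_injective hinj⟩

/-- The ultrametric on the labels given by the vertices where the paths of a tree meet. -/
def binaryUltrametric {I : Type*} [DecidableEq I] [Fintype I] (T : Forest I)
    (hT : ∀ i j, T.trees i j) (p : Finset I → ℕ) (hp : StrictMono p)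
    (hinj : Function.Injective p) : BinaryUltrametric I where
  dist i j := p (T.meetVertex i j)
  symm i j := by rw [T.meetVertex_comm]
  ultra i j k := by
    rcases T.subset_or_subset (T.meetVertex_mem (hT i j)) (T.meetVertex_mem (hT j k))
      (T.right_mem_meetVertex i j) (T.left_mem_meetVertex j k) with h | h
    · exact le_max_of_le_right (hp.monotone (T.meetVertex_subset (T.meetVertex_mem (hT j k))
        (h (T.left_mem_meetVertex i j)) (T.right_mem_meetVertex j k)))
    · exact le_max_of_le_left (hp.monotone (T.meetVertex_subset (T.meetVertex_mem (hT i j))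
        (T.left_mem_meetVertex i j) (h (T.right_mem_meetVertex j k))))
  binary i j k l hij h := by
    have he := hinj h
    obtain ⟨a, ha, b, hb, hab, hu, hi, hj⟩ := T.exists_children hij (hT i j)
    have hkl : ∀ c ∈ T.verts, ∀ x y, x ∈ c → y ∈ c → c ⊂ T.meetVertex i j →
        p (T.meetVertex x y) < p (T.meetVertex i j) := fun c hc x y hx hy hlt =>
      hp (lt_of_le_of_lt (T.meetVertex_subset hc hx hy) hlt)
    have hai : a ⊂ T.meetVertex i j := by
      refine ⟨hu ▸ Finset.subset_union_left, fun h => ?_⟩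
      exact Finset.disjoint_left.1 hab (h (T.right_mem_meetVertex i j)) hj
    have hbj : b ⊂ T.meetVertex i j := by
      refine ⟨hu ▸ Finset.subset_union_right, fun h => ?_⟩
      exact Finset.disjoint_left.1 hab hi (h (T.left_mem_meetVertex i j))
    have hk : k ∈ a ∪ b := by
      rw [hu, he]
      exact T.left_mem_meetVertex k l
    have hl : l ∈ a ∪ b := by
      rw [hu, he]
      exact T.right_mem_meetVertex k l
    have hlt : p (T.meetVertex i j) = p (T.meetVertex k l) := h
    -- Were `k` and `l` under the same child, their paths would meet there or below; so they are on
    -- opposite sides.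
    rcases Finset.mem_union.1 hk with hk | hk <;> rcases Finset.mem_union.1 hl with hl | hl
    · exact absurd (hkl a ha k l hk hl hai) (by omega)
    · exact Or.inl ⟨hkl a ha i k hi hk hai, hkl b hb j l hj hl hbj⟩
    · exact Or.inr ⟨hkl a ha i l hi hl hai, hkl b hb j k hj hk hbj⟩
    · exact absurd (hkl b hb k l hk hl hbj) (by omega)

end Forest

theorem mainTheorem3 {I : Type*} [Fintype I] [DecidableEq I] (T : Forest I) (hT : T.IsTree) :
    ∃ L : Lattice (Set.Icc (Forest.zero I) T),
      (∀ F G : Set.Icc (Forest.zero I) T, L.le F G ↔ (F : Forest I) ≤ (G : Forest I)) ∧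
      @IsSupersolvable (Set.Icc (Forest.zero I) T) L := by
  have hT' : ∀ i j, T.trees i j := by
    obtain ⟨r, hr⟩ := hT
    exact fun i j => T.trees_of_mem r.2 (hr (T.leaf i) (Finset.mem_singleton_self i))
      (hr (T.leaf j) (Finset.mem_singleton_self j))
  obtain ⟨p, hinj, hp⟩ := Forest.exists_injective_strictMono (Finset I)
  -- As `p` is injective, equal distances mean equal meeting vertices, so validity is the last
  -- condition of `Forest.le_iff`.
  have hvalid : ∀ r : Setoid I, (T.binaryUltrametric hT' p hp hinj).Valid r ↔
      ∀ i j k l, i ≠ j → k ≠ l → r i j → r k l → T.meetVertex i j = T.meetVertex k l → r i k :=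
    fun r => ⟨fun h i j k l hij hkl h1 h2 he => h i j k l hij hkl h1 h2 (congrArg p he),
      fun h i j k l hij hkl h1 h2 he => h i j k l hij hkl h1 h2 (hinj he)⟩
  refine (T.binaryUltrametric hT' p hp hinj).exists_lattice_isSupersolvable
    (fun F : Set.Icc (Forest.zero I) T => F.1.trees) ?_ ?_ ?_
  · exact fun F G => Forest.trees_le_trees_iff F.2.2 G.2.2
  · exact fun F => (hvalid _).2 (Forest.le_iff.1 F.2.2).2.2
  · intro r hr
    have htr := Forest.restrict_trees hT' r
    refine ⟨⟨T.restrict r, Forest.zero_le _, Forest.le_of_trees_le (fun i j _ => hT' i j) ?_ ?_⟩,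
      htr⟩
    · rw [htr]
      exact fun i j k hij hik => Forest.mem_restrict_meetVertex hij hik
    · rw [htr]
      exact (hvalid r).1 hr
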